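/- Let $N$ be a finite non-empty set of players, let $n_\nu\in\mathbb{N}$ for $\nu\in N$, put $\mathbb{R}^n=\prod_{\nu\in N}\mathbb{R}^{n_\nu}$, and let $\|\cdot\|$ be a norm on $\mathbb{R}^n$. For $x,y\in\mathbb{R}^n$ and $\nu\in N$, let $(y^\nu,x^{-\nu})$ denote the vector obtained from $x$ by replacing its block $x^\nu\in\mathbb{R}^{n_\nu}$ by $y^\nu$. Let $X\subseteq\mathbb{R}^n$ be convex, closed and non-empty, and for each $\nu\in N$ let $\theta_\nu:\mathbb{R}^n\to\mathbb{R}$ be a continuous function that is convex with respect to its player's variable, i.e. $z\mapsto\theta_\nu(z,x^{-\nu})$ is convex on $\mathbb{R}^{n_\nu}$ for every $x\in\mathbb{R}^n$. Suppose that for some $\rho>0$ the coerciveness condition $(C_0)$ holds: 1. there is a point $x\in X$ with $\|x\|\le\rho$; and 2. for each $x\in X$ with $\|x\|=\rho$ there exists $y\in X$ such that $\|y\|<\rho$ and $\theta_\nu(y^\nu,x^{-\nu})\le\theta_\nu(x)$ for all $\nu\in N$. Then Rosen's generalized Nash equilibrium problem has a solution: there is a vector $\hat x\in X$ such that, for every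 $\nu\in N$, $$\theta_\nu(\hat x)\le\theta_\nu(z,\hat x^{-\nu})\quad\text{for all } z\in\mathbb{R}^{n_\nu}\text{ with }(z,\hat x^{-\nu})\in X.$$ -/

import Mathlib

namespace RosenGame

/-- The space of strategy profiles: the Cartesian product over the players `ν` of the spaces
`ℝ ^ (n ν)`, with its usual (product) topology. -/
abbrev Profile {N : Type*} (n : N → ℕ) : Type _ := (ν : N) → Fin (n ν) → ℝ

/-- The profile `(z, x^{-ν})`: player `ν` plays `z`, every other player plays as in `x`. -/
def deviate {N : Type*} [DecidableEq N] {n : N → ℕ} (x : Profile n) (ν : N)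
    (z : Fin (n ν) → ℝ) : Profile n :=
  Function.update x ν z

/-- The constraint set `X_ν(x^{-ν})` of player `ν` that is induced by the shared constraint `X`:
all `z` in `ℝ ^ (n ν)` with `(z, x^{-ν}) ∈ X`. -/
def constraintSet {N : Type*} [DecidableEq N] {n : N → ℕ} (X : Set (Profile n)) (ν : N)
    (x : Profile n) : Set (Fin (n ν) → ℝ) :=
  {z | deviate x ν z ∈ X}

/-- The set of generalized Nash equilibria of the Rosen game with losses `θ ν` and shared
constraint `X`: for each player `ν`, the strategy `x ν` minimizes `θ ν (·, x^{-ν})` over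
`X_ν(x^{-ν})` (in particular it belongs to that set). -/
def equilibria {N : Type*} [DecidableEq N] {n : N → ℕ} (θ : N → Profile n → ℝ)
    (X : Set (Profile n)) : Set (Profile n) :=
  {x | ∀ ν, x ν ∈ constraintSet X ν x ∧
    ∀ z ∈ constraintSet X ν x, θ ν (deviate x ν (x ν)) ≤ θ ν (deviate x ν z)}

/-- `θ ν` is convex with respect to the variable of player `ν`. -/
def ConvexInOwnVariable {N : Type*} [DecidableEq N] {n : N → ℕ} (θ : N → Profile n → ℝ)
    (ν : N) : Prop :=
  ∀ x : Profile n, ConvexOn ℝ Set.univ (fun z : Fin (n ν) → ℝ => θ ν (deviate x ν z))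

/-- The coerciveness condition `(C₀)` at `ρ`, with respect to the (semi)norm `p` on the space
of profiles. -/
def CoerciveC0 {N : Type*} [DecidableEq N] {n : N → ℕ} (p : Seminorm ℝ (Profile n))
    (θ : N → Profile n → ℝ) (X : Set (Profile n)) (ρ : ℝ) : Prop :=
  (X ∩ {x | p x ≤ ρ}).Nonempty ∧
    ∀ x ∈ X, p x = ρ → ∃ y ∈ X, p y < ρ ∧ ∀ ν, θ ν (deviate x ν (y ν)) ≤ θ ν x

end RosenGame

/-! Put `φ x y = ∑ ν, θ ν (y^ν, x^{-ν})` (the Nikaido–Isoda function), which is continuous and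
convex in `y`. If `x ∈ X` minimizes `φ x` over `X`, testing against unilateral deviations shows that
`x` is an equilibrium. Ky Fan's inequality (`exists_forall_le_of_convexOn`) gives such an `x` on the
compact set `X ∩ {p ≤ ρ}`. By `(C₀)` the value `φ x x` is attained or improved at a point of norm
below `ρ`, and convexity then extends minimality to all of `X`
(`ConvexOn.le_of_forall_seminorm_le`).

Ky Fan's inequality follows from Brouwer's theorem on a simplex through Nash's map, and Brouwer's
theorem from `scarf_lemma`, a parity argument. Incidences between dominant sets and sets carrying
all colours but one are counted twice: a dominant set that misses a colour contributes evenly, and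
so does every almost coloured set except one on the boundary. -/

/-! ### Dominant sets and Scarf's lemma -/

/-- A finite set `S` is dominant for the family of rankings `r` if no point is ranked strictly
above the lowest point of `S` by every ranking. -/
def DominantSet {V I : Type*} (r : I → V → ℕ) (S : Finset V) : Prop :=
  ∀ y, ∃ i, ∀ x ∈ S, r i y ≤ r i x

theorem DominantSet.mono {V I : Type*} {r : I → V → ℕ} {S S' : Finset V}
    (h : DominantSet r S) (hS : S' ⊆ S) : DominantSet r S' := fun y =>
  (h y).imp fun _ hi x hx => hi x (hS hx)

open Classical in
/-- A dominant set with one element less than there are rankings extends to a dominant set by one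
point in exactly two ways, provided that for every ranking `j` some point lies strictly above the
lowest point in all rankings but `j`. -/
theorem DominantSet.card_extensions_eq_two {V I : Type*} [Fintype V] [DecidableEq V] [Fintype I]
    {r : I → V → ℕ} (hr : ∀ i, Function.Injective (r i)) {τ : Finset V}
    (hcard : τ.card + 1 = Fintype.card I) (hne : τ.Nonempty) (hdom : DominantSet r τ)
    (hM : ∀ j, ∃ y, ∀ i, i ≠ j → ∃ x ∈ τ, r i x < r i y) :
    (Finset.univ.filter fun x => x ∉ τ ∧ DominantSet r (insert x τ)).card = 2 := by
  have hmin : ∀ i, ∃ v ∈ τ, ∀ x ∈ τ, r i v ≤ r i x := fun i => τ.exists_min_image (r i) hne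
  choose m hmτ hm using hmin
  have hsurj : ∀ x ∈ τ, ∃ i, m i = x := by
    intro x hx
    obtain ⟨i, hi⟩ := hdom x
    exact ⟨i, hr i (le_antisymm (hm i x hx) (hi _ (hmτ i)))⟩
  have hno : ∀ y, ¬ ∀ i, r i (m i) < r i y := by
    intro y hy
    obtain ⟨i, hi⟩ := hdom y
    exact absurd (hi _ (hmτ i)) (not_le.2 (hy i))
  -- There is one ranking more than points of `τ`, so the surjection `m` has a single collision `m a
  -- = m b`. The two extensions will be by `Y a` and `Y b`.
  obtain ⟨a, -, b, -, hab, hmab⟩ := Finset.exists_ne_map_eq_of_card_lt_of_maps_to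
    (s := (Finset.univ : Finset I)) (t := τ) (f := m)
    (by rw [Finset.card_univ]; omega) (fun i _ => hmτ i)
  have hsurj' : ∀ j, j = a ∨ j = b → ∀ x ∈ τ, ∃ i, i ≠ j ∧ m i = x := by
    intro j hj x hx
    obtain ⟨i, hi⟩ := hsurj x hx
    by_cases hij : i = j
    · rcases hj with rfl | rfl
      · exact ⟨b, hab.symm, by rw [← hmab, ← hij, hi]⟩
      · exact ⟨a, hab, by rw [hmab, ← hij, hi]⟩
    · exact ⟨i, hij, hi⟩
  have hinj : ∀ j, j = a ∨ j = b → ∀ i i', i ≠ j → i' ≠ j → m i = m i' → i = i' := by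
    intro j hj i i' hi hi' h
    have := Finset.injOn_of_surjOn_of_card_le (s := Finset.univ.erase j) (t := τ) m
      (fun i _ => hmτ i)
      (fun x hx => by
        obtain ⟨i, hi, h⟩ := hsurj' j hj x hx
        exact ⟨i, by simpa using hi, h⟩)
      (by rw [Finset.card_erase_of_mem (Finset.mem_univ _), Finset.card_univ]; omega)
    exact this (by simpa using hi) (by simpa using hi') h
  have hY : ∀ j, ∃ y, (∀ i, i ≠ j → r i (m i) < r i y) ∧
      ∀ z, (∀ i, i ≠ j → r i (m i) < r i z) → r j z ≤ r j y := by
    intro j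
    obtain ⟨y, hy⟩ := hM j
    obtain ⟨w, hw, hw'⟩ := (Finset.univ.filter fun z => ∀ i, i ≠ j → r i (m i) < r i z).exists_max_image
      (r j) ⟨y, by
        simp only [Finset.mem_filter, Finset.mem_univ, true_and]
        intro i hi
        obtain ⟨x, hx, hxy⟩ := hy i hi
        exact (hm i x hx).trans_lt hxy⟩
    simp only [Finset.mem_filter, Finset.mem_univ, true_and] at hw hw'
    exact ⟨w, hw, hw'⟩
  choose Y hYM hYmax using hY
  have hYτ : ∀ j, j = a ∨ j = b → Y j ∉ τ := by
    intro j hj h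
    obtain ⟨i, hi, hi'⟩ := hsurj' j hj _ h
    exact absurd (hYM j i hi) (by rw [hi']; exact lt_irrefl _)
  have hYdom : ∀ j, DominantSet r (insert (Y j) τ) := by
    intro j z
    by_contra hcon
    push Not at hcon
    have hz : ∀ i, i ≠ j → r i (m i) < r i z := by
      intro i hi
      obtain ⟨x, hx, hxz⟩ := hcon i
      rcases Finset.mem_insert.1 hx with rfl | hx
      · exact (hYM j i hi).trans hxz
      · exact (hm i x hx).trans_lt hxz
    have hzj := hYmax j z hz
    obtain ⟨x, hx, hxz⟩ := hcon j
    rcases Finset.mem_insert.1 hx with rfl | hxτ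
    · omega
    · refine hno z fun i => ?_
      by_cases hi : i = j
      · subst hi; exact (hm i x hxτ).trans_lt hxz
      · exact hz i hi
  have hYab : Y a ≠ Y b := by
    intro h
    refine hno (Y a) fun i => ?_
    by_cases hi : i = a
    · rw [h]; exact hYM b i (by rw [hi]; exact hab)
    · exact hYM a i hi
  rw [Finset.card_eq_two]
  refine ⟨Y a, Y b, hYab, ?_⟩
  ext x
  simp only [Finset.mem_filter, Finset.mem_univ, true_and, Finset.mem_insert,
    Finset.mem_singleton]
  constructor
  · rintro ⟨hx, hxdom⟩
    have hlt : ∀ v ∈ τ, ∃ i, m i = v ∧ r i (m i) < r i x := by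
      intro v hv
      obtain ⟨i, hi⟩ := hxdom v
      have hmv : m i = v :=
        hr i (le_antisymm (hm i v hv) (hi _ (Finset.mem_insert_of_mem (hmτ i))))
      refine ⟨i, hmv, ?_⟩
      rw [hmv]
      refine lt_of_le_of_ne (hi x (Finset.mem_insert_self _ _)) fun h => hx ?_
      rw [← hr i h]; exact hv
    obtain ⟨k, hk⟩ : ∃ k, r k x ≤ r k (m k) := by
      by_contra h
      push Not at h
      exact hno x h
    -- Otherwise `k` is the only ranking with lowest point `m k`, and `hlt` at `m k` contradicts
    -- `hk`.
    have hkab : k = a ∨ k = b := by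
      by_contra h
      push Not at h
      obtain ⟨i, hi, hi'⟩ := hlt (m k) (hmτ k)
      have hik : i ≠ k := by rintro rfl; omega
      have h1 : i = a := by
        by_contra hia
        exact hik (hinj a (Or.inl rfl) i k hia h.1 hi)
      have h2 : i = b := by
        by_contra hib
        exact hik (hinj b (Or.inr rfl) i k hib h.2 hi)
      exact hab (h1.symm.trans h2)
    have hxM : ∀ i, i ≠ k → r i (m i) < r i x := by
      intro i hi
      obtain ⟨i', hi', hlt'⟩ := hlt (m i) (hmτ i)
      have hik : i' ≠ k := by rintro rfl; omega
      rwa [hinj k hkab i' i hik hi hi'] at hlt'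
    have hxY : x = Y k := by
      refine hr k (le_antisymm (hYmax k x hxM) ?_)
      obtain ⟨i, hi⟩ := hxdom (Y k)
      by_cases hik : i = k
      · subst hik; exact hi x (Finset.mem_insert_self _ _)
      · exact absurd (hi _ (Finset.mem_insert_of_mem (hmτ i))) (not_le.2 (hYM k i hik))
    rcases hkab with rfl | rfl
    · exact Or.inl hxY
    · exact Or.inr hxY
  · rintro (rfl | rfl)
    · exact ⟨hYτ a (Or.inl rfl), hYdom a⟩
    · exact ⟨hYτ b (Or.inr rfl), hYdom b⟩

open Classical in
/-- Among the sets obtained by deleting a point from a set `S` with as many elements as there are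
colours but not carrying all colours, an even number carries all colours except `i₀`. -/
theorem even_card_erase_image_eq {V I : Type*} [Fintype V] [DecidableEq V] [Fintype I]
    [DecidableEq I] (c : V → I) (i₀ : I)
    {S : Finset V} (hcard : S.card = Fintype.card I) (hS : S.image c ≠ Finset.univ) :
    Even (Finset.univ.filter fun x =>
      x ∈ S ∧ (S.erase x).image c = Finset.univ.erase i₀).card := by
  rcases (Finset.univ.filter fun x =>
      x ∈ S ∧ (S.erase x).image c = Finset.univ.erase i₀).eq_empty_or_nonempty with h | ⟨x, hx⟩
  · rw [h]; simp
  simp only [Finset.mem_filter, Finset.mem_univ, true_and] at hx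
  obtain ⟨hxS, hx⟩ := hx
  -- `S.erase x` has as many points as colours. Hence `c x` is repeated exactly once, at `x'`, and
  -- only `x` or `x'` can be removed without losing a colour.
  have hinj : Set.InjOn c (S.erase x) := by
    rw [← Finset.card_image_iff, hx, Finset.card_erase_of_mem (Finset.mem_univ _),
      Finset.card_erase_of_mem hxS, hcard, Finset.card_univ]
  have hcx : c x ∈ (S.erase x).image c := by
    rw [hx]
    refine Finset.mem_erase.2 ⟨fun h => hS ?_, Finset.mem_univ _⟩
    rw [← Finset.insert_erase hxS, Finset.image_insert, hx, h,
      Finset.insert_erase (Finset.mem_univ _)]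
  obtain ⟨x', hx', hcx'⟩ := Finset.mem_image.1 hcx
  have hx'S := Finset.mem_of_mem_erase hx'
  have hne : x' ≠ x := Finset.ne_of_mem_erase hx'
  suffices h : (Finset.univ.filter fun x =>
      x ∈ S ∧ (S.erase x).image c = Finset.univ.erase i₀) = {x, x'} by
    rw [h, Finset.card_pair hne.symm]; exact even_two
  have himg : S.image c = Finset.univ.erase i₀ := by
    rw [← Finset.insert_erase hxS, Finset.image_insert, Finset.insert_eq_of_mem hcx, hx]
  ext z
  simp only [Finset.mem_filter, Finset.mem_univ, true_and, Finset.mem_insert,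
    Finset.mem_singleton]
  constructor
  · rintro ⟨hzS, hz⟩
    by_contra hcon
    push Not at hcon
    have hcz : c z ∈ (S.erase z).image c := by
      rw [hz, ← himg]; exact Finset.mem_image_of_mem c hzS
    obtain ⟨w, hw, hwz⟩ := Finset.mem_image.1 hcz
    have hwS := Finset.mem_of_mem_erase hw
    have hwne := Finset.ne_of_mem_erase hw
    have hzx : z ∈ S.erase x := Finset.mem_erase.2 ⟨hcon.1, hzS⟩
    by_cases hwx : w = x
    · subst hwx
      exact hcon.2 (hinj hzx hx' (by rw [← hwz, hcx']))
    · exact hwne (hinj (Finset.mem_erase.2 ⟨hwx, hwS⟩) hzx hwz)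
  · rintro (rfl | rfl)
    · exact ⟨hxS, hx⟩
    · refine ⟨hx'S, ?_⟩
      rw [← himg]
      refine (Finset.image_subset_image (Finset.erase_subset _ _)).antisymm fun k hk => ?_
      obtain ⟨w, hw, rfl⟩ := Finset.mem_image.1 hk
      by_cases hwz : w = z
      · subst hwz
        rw [hcx']
        exact Finset.mem_image_of_mem c (Finset.mem_erase.2 ⟨hne.symm, hxS⟩)
      · exact Finset.mem_image_of_mem c (Finset.mem_erase.2 ⟨hwz, hw⟩)

open Classical in
/-- For rankings of the points of `T` together with one extra point per ranking, which is lowest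
in its own ranking and above all points of `T` in the others, a dominant set carrying all colours
exists. -/
theorem exists_dominantSet_image_eq_univ {T I : Type*} [Fintype T] [Fintype I] (i₀ : I)
    {r : I → T ⊕ I → ℕ} (hr : ∀ i, Function.Injective (r i))
    (hbot : ∀ i v, r i (Sum.inr i) ≤ r i v)
    (htop : ∀ i j t, i ≠ j → r i (Sum.inl t) < r i (Sum.inr j)) (c : T → I) :
    ∃ S : Finset (T ⊕ I), DominantSet r S ∧ S.image (Sum.elim c id) = Finset.univ := by
  set c' : T ⊕ I → I := Sum.elim c id with hc'
  by_contra hcon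
  push Not at hcon
  -- `A` and `B` list the same incidences, by point to delete and by point to add. Without a fully
  -- coloured dominant set `A` is even, while `B` is odd.
  let A : Finset (Finset (T ⊕ I) × (T ⊕ I)) := Finset.univ.filter fun q =>
    (q.1.card = Fintype.card I ∧ DominantSet r q.1) ∧
      (q.2 ∈ q.1 ∧ (q.1.erase q.2).image c' = Finset.univ.erase i₀)
  let B : Finset (Finset (T ⊕ I) × (T ⊕ I)) := Finset.univ.filter fun q =>
    (q.1.card + 1 = Fintype.card I ∧ q.1.image c' = Finset.univ.erase i₀) ∧
      (q.2 ∉ q.1 ∧ DominantSet r (insert q.2 q.1))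
  have hAB : A.card = B.card := by
    refine Finset.card_bij' (fun q _ => (q.1.erase q.2, q.2)) (fun q _ => (insert q.2 q.1, q.2))
      ?_ ?_ ?_ ?_
    · rintro ⟨S, x⟩ h
      simp only [A, B, Finset.mem_filter, Finset.mem_univ, true_and] at h ⊢
      obtain ⟨⟨h1, h2⟩, h3, h4⟩ := h
      refine ⟨⟨?_, h4⟩, by simp, by rwa [Finset.insert_erase h3]⟩
      rw [Finset.card_erase_add_one h3, h1]
    · rintro ⟨S, x⟩ h
      simp only [A, B, Finset.mem_filter, Finset.mem_univ, true_and] at h ⊢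
      obtain ⟨⟨h1, h2⟩, h3, h4⟩ := h
      refine ⟨⟨?_, h4⟩, by simp, by rwa [Finset.erase_insert h3]⟩
      rw [Finset.card_insert_of_notMem h3, h1]
    · rintro ⟨S, x⟩ h
      simp only [A, Finset.mem_filter, Finset.mem_univ, true_and] at h
      simp [Finset.insert_erase h.2.1]
    · rintro ⟨S, x⟩ h
      simp only [B, Finset.mem_filter, Finset.mem_univ, true_and] at h
      simp [Finset.erase_insert h.2.1]
  have hfib : ∀ (P : Finset (T ⊕ I) → Prop) [DecidablePred P]
      (Q : Finset (T ⊕ I) → T ⊕ I → Prop) [∀ S, DecidablePred (Q S)],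
      (Finset.univ.filter fun q : Finset (T ⊕ I) × (T ⊕ I) => P q.1 ∧ Q q.1 q.2).card =
        ∑ S : Finset (T ⊕ I), if P S then (Finset.univ.filter fun x => Q S x).card else 0 := by
    intro P _ Q _
    rw [Finset.card_filter, ← Finset.univ_product_univ, Finset.sum_product]
    refine Finset.sum_congr rfl fun S _ => ?_
    rw [Finset.card_filter]
    by_cases h : P S <;> simp only [h, true_and, false_and, if_true, if_false,
      Finset.sum_const_zero]
  have hA : Even A.card := by
    rw [show A.card = _ from hfib (fun S => S.card = Fintype.card I ∧ DominantSet r S)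
      (fun S x => x ∈ S ∧ (S.erase x).image c' = Finset.univ.erase i₀)]
    refine Finset.even_sum _ fun S _ => ?_
    split_ifs with h
    · exact even_card_erase_image_eq c' i₀ h.1 (hcon S h.2)
    · simp
  -- The boundary set: only the `i₀`-highest point outside it extends it to a dominant set.
  let τ₀ : Finset (T ⊕ I) := (Finset.univ.erase i₀).image Sum.inr
  have hmem₀ : ∀ v, v ∈ τ₀ ↔ ∃ j, j ≠ i₀ ∧ Sum.inr j = v := by
    intro v; simp [τ₀]
  have hτ₀ : (τ₀.card + 1 = Fintype.card I ∧ τ₀.image c' = Finset.univ.erase i₀) := by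
    constructor
    · rw [Finset.card_image_of_injective _ Sum.inr_injective,
        Finset.card_erase_add_one (Finset.mem_univ _), Finset.card_univ]
    · ext
      simp [τ₀, hc']
  have hτ₀card : (Finset.univ.filter fun x => x ∉ τ₀ ∧ DominantSet r (insert x τ₀)).card = 1 := by
    obtain ⟨w, hw, hwmax⟩ := (Finset.univ.filter fun x => x ∉ τ₀).exists_max_image (r i₀)
      ⟨Sum.inr i₀, by simp [τ₀]⟩
    simp only [Finset.mem_filter, Finset.mem_univ, true_and] at hw hwmax
    rw [Finset.card_eq_one]
    refine ⟨w, ?_⟩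
    ext x
    simp only [Finset.mem_filter, Finset.mem_univ, true_and, Finset.mem_singleton]
    constructor
    · rintro ⟨hx, hxd⟩
      obtain ⟨i, hi⟩ := hxd w
      by_cases hii : i = i₀
      · subst hii
        exact hr i (le_antisymm (hwmax x hx) (hi x (Finset.mem_insert_self _ _)))
      · exfalso
        have hiτ : Sum.inr i ∈ τ₀ := (hmem₀ _).2 ⟨i, hii, rfl⟩
        have := hr i (le_antisymm (hi _ (Finset.mem_insert_of_mem hiτ)) (hbot i w))
        exact hw (this ▸ hiτ)
    · rintro rfl
      refine ⟨hw, fun y => ?_⟩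
      by_cases hy : y ∈ τ₀
      · obtain ⟨j, hj, rfl⟩ := (hmem₀ _).1 hy
        exact ⟨j, fun v _ => hbot j v⟩
      · refine ⟨i₀, fun v hv => ?_⟩
        rcases Finset.mem_insert.1 hv with rfl | hv
        · exact hwmax y hy
        · obtain ⟨j, hj, rfl⟩ := (hmem₀ _).1 hv
          rcases y with t | k
          · exact (htop _ _ _ hj.symm).le
          · have : k = i₀ := by
              by_contra hk
              exact hy ((hmem₀ _).2 ⟨k, hk, rfl⟩)
            rw [this]; exact hbot _ _
  have hB : ¬ Even B.card := by
    rw [show B.card = _ from hfib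
      (fun S => S.card + 1 = Fintype.card I ∧ S.image c' = Finset.univ.erase i₀)
      (fun S x => x ∉ S ∧ DominantSet r (insert x S)),
      ← Finset.sum_erase_add _ _ (Finset.mem_univ τ₀), if_pos hτ₀, hτ₀card,
      Nat.not_even_iff_odd]
    refine Even.add_one (Finset.even_sum _ fun τ hτ => ?_)
    split_ifs with h
    · rcases (Finset.univ.filter fun x => x ∉ τ ∧ DominantSet r (insert x τ)).eq_empty_or_nonempty
        with he | ⟨x, hx⟩
      · rw [he]; simp
      · simp only [Finset.mem_filter, Finset.mem_univ, true_and] at hx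
        have hτd : DominantSet r τ := hx.2.mono (Finset.subset_insert _ _)
        -- A set of extra points is determined by its colours, so it could only be `τ₀`.
        have hinl : ∃ t, Sum.inl t ∈ τ := by
          by_contra hno
          push Not at hno
          refine Finset.ne_of_mem_erase hτ ?_
          ext v
          rcases v with t | k
          · simp [hno t, τ₀]
          · have : k ∈ τ.image c' ↔ Sum.inr k ∈ τ := by
              simp only [Finset.mem_image, Sum.exists, hc', Sum.elim_inl, Sum.elim_inr, id]
              constructor
              · rintro (⟨t, ht, -⟩ | ⟨j, hj, rfl⟩)
                · exact absurd ht (hno t)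
                · exact hj
              · exact fun hk => Or.inr ⟨k, hk, rfl⟩
            rw [← this, h.2]
            simp [τ₀]
        obtain ⟨t, ht⟩ := hinl
        rw [DominantSet.card_extensions_eq_two hr h.1 ⟨_, ht⟩ hτd
          fun j => ⟨Sum.inr j, fun i hi => ⟨_, ht, htop i j t hi⟩⟩]
        exact even_two
    · simp
  exact hB (hAB ▸ hA)

/-- **Scarf's lemma**: given finitely many injective rankings of a finite set `T`, coloured by the
rankings, there is a set `S` such that every point of `T` is ranked at or below all of `S` by a
ranking that occurs as a colour in `S`. -/
theorem scarf_lemma {T I : Type*} [Fintype T] [Nonempty T] [Fintype I]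
    {u : I → T → ℕ} (hu : ∀ i, Function.Injective (u i)) (c : T → I) :
    ∃ S : Finset T, S.Nonempty ∧ ∀ y, ∃ s ∈ S, ∀ x ∈ S, u (c s) y ≤ u (c s) x := by
  classical
  obtain ⟨t₀⟩ := ‹Nonempty T›
  obtain ⟨L, hL⟩ : ∃ L, ∀ i t, u i t < L := by
    refine ⟨(∑ i, ∑ t, u i t) + 1, fun i t => Nat.lt_succ_of_le ?_⟩
    exact (Finset.single_le_sum (f := fun t => u i t) (fun _ _ => Nat.zero_le _)
      (Finset.mem_univ t)).trans (Finset.single_le_sum (f := fun i => ∑ t, u i t)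
      (fun _ _ => Nat.zero_le _) (Finset.mem_univ i))
  let e := Fintype.equivFin I
  -- The shift by one puts the extra point of ranking `i` strictly below `T`, so it cannot lie in
  -- `S` when `i` dominates a point of `T`. The term `e j` only breaks ties.
  let r : I → T ⊕ I → ℕ := fun i =>
    Sum.elim (fun t => u i t + 1) (fun j => if i = j then 0 else L + 1 + e j)
  obtain ⟨S, hS, hc⟩ := exists_dominantSet_image_eq_univ (r := r) (c t₀)
    (by
      rintro i (t | j) (t' | j') h
      · simp only [r, Sum.elim_inl, add_left_inj] at h
        rw [hu i h]
      · have := hL i t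
        simp only [r, Sum.elim_inl, Sum.elim_inr] at h
        split_ifs at h
        all_goals omega
      · have := hL i t'
        simp only [r, Sum.elim_inl, Sum.elim_inr] at h
        split_ifs at h
        all_goals omega
      · simp only [r, Sum.elim_inr] at h
        split_ifs at h with h1 h2 h2
        · rw [← h1, ← h2]
        · omega
        · omega
        · rw [e.injective (Fin.ext (by omega : (e j : ℕ) = e j'))])
    (by intro i v; simp [r])
    (by
      intro i j t hij
      have := hL i t
      simp only [r, Sum.elim_inl, Sum.elim_inr, if_neg hij]
      omega) c
  have key : ∀ y, ∃ s, Sum.inl s ∈ S ∧ ∀ x, Sum.inl x ∈ S → u (c s) y ≤ u (c s) x := by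
    intro y
    obtain ⟨i, hi⟩ := hS (Sum.inl y)
    obtain ⟨v, hv, hvi⟩ := Finset.mem_image.1 (hc ▸ Finset.mem_univ i)
    rcases v with s | j
    · simp only [Sum.elim_inl] at hvi
      subst hvi
      exact ⟨s, hv, fun x hx => by simpa [r] using hi _ hx⟩
    · simp only [Sum.elim_inr, id] at hvi
      subst hvi
      have := hi _ hv
      simp [r] at this
  refine ⟨Finset.univ.filter fun t => Sum.inl t ∈ S, ?_, fun y => ?_⟩
  · obtain ⟨s, hs, -⟩ := key t₀
    exact ⟨s, by simpa using hs⟩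
  · obtain ⟨s, hs, h⟩ := key y
    exact ⟨s, by simpa using hs, fun x hx => h x (by simpa using hx)⟩

/-! ### Brouwer's fixed point theorem on the simplex -/

/-- A colouring of the grid points of a dilated simplex has a non-empty set of close grid points
such that the coordinates of all colours that do not occur in it are small. -/
theorem exists_close_grid_points {I : Type*} [Fintype I] [DecidableEq I] [Nonempty I] (N : ℕ)
    (c : (Finset.univ : Finset I).piAntidiag N → I) :
    ∃ S : Finset ((Finset.univ : Finset I).piAntidiag N), S.Nonempty ∧
      (∀ x ∈ S, ∀ y ∈ S, ∀ i, x.1 i < y.1 i + Fintype.card I) ∧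
      ∀ i, (∀ s ∈ S, c s ≠ i) → ∀ x ∈ S, x.1 i < Fintype.card I := by
  have hT : ∀ x : (Finset.univ : Finset I).piAntidiag N, ∑ i, x.1 i = N := fun x =>
    (Finset.mem_piAntidiag.1 x.2).1
  obtain ⟨i₁⟩ := ‹Nonempty I›
  have : Nonempty ((Finset.univ : Finset I).piAntidiag N) :=
    ⟨⟨Pi.single i₁ N, by simp [Finset.mem_piAntidiag]⟩⟩
  let M := Fintype.card ((Finset.univ : Finset I).piAntidiag N)
  let e := Fintype.equivFin ((Finset.univ : Finset I).piAntidiag N)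
  -- Since `e t < M`, this orders by the `i`-th coordinate and breaks ties.
  let u : I → (Finset.univ : Finset I).piAntidiag N → ℕ := fun i t => t.1 i * M + e t
  have hu : ∀ i x y, u i y ≤ u i x → y.1 i ≤ x.1 i := by
    intro i x y h
    have h1 : y.1 i * M < (x.1 i + 1) * M := by
      have := (e x).2
      rw [add_mul, one_mul]
      simp only [u] at h
      omega
    exact Nat.lt_succ_iff.1 (Nat.lt_of_mul_lt_mul_right h1)
  have huinj : ∀ i, Function.Injective (u i) := by
    intro i x y h
    have h1 := le_antisymm (hu i y x h.le) (hu i x y h.ge)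
    simp only [u, h1, add_right_inj] at h
    exact e.injective (Fin.ext h)
  obtain ⟨S, hS, hdom⟩ := scarf_lemma huinj c
  have hmin : ∀ i, ∃ v ∈ S, ∀ x ∈ S, v.1 i ≤ x.1 i := fun i =>
    S.exists_min_image (fun x => x.1 i) hS
  choose m hmS hm using hmin
  let g : I → ℕ := fun i => if i ∈ S.image c then (m i).1 i + 1 else 0
  let b : I → ℕ := fun i => if i ∈ S.image c then (m i).1 i else 0
  -- Otherwise some grid point `y ≥ g` exceeds the minimum over `S` of every occurring coordinate,
  -- against `hdom`. So `∑ i, b i > N - |I|`, and points of `S`, which lie above `b` with sum `N`,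
  -- are within `|I|` of `b`.
  have hg : N < ∑ i, g i := by
    by_contra hle
    push Not at hle
    obtain ⟨s₀, hs₀⟩ := hS
    let y : I → ℕ := g + Pi.single (c s₀) (N - ∑ i, g i)
    have hy : y ∈ (Finset.univ : Finset I).piAntidiag N := by
      simp only [Finset.mem_piAntidiag, Finset.mem_univ, implies_true, and_true, y, Pi.add_apply,
        Finset.sum_add_distrib, Finset.sum_pi_single', if_true]
      omega
    obtain ⟨s, hs, h⟩ := hdom ⟨y, hy⟩
    have h1 : y (c s) ≤ (m (c s)).1 (c s) := hu _ _ _ (h _ (hmS (c s)))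
    have h2 : g (c s) = (m (c s)).1 (c s) + 1 := if_pos (Finset.mem_image_of_mem c hs)
    simp only [y, Pi.add_apply] at h1
    omega
  have hgb : ∑ i, g i ≤ ∑ i, b i + Fintype.card I := by
    calc ∑ i, g i ≤ ∑ i, (b i + 1) := Finset.sum_le_sum fun i _ => by
          simp only [g, b]; split_ifs <;> omega
      _ = _ := by simp [Finset.sum_add_distrib]
  have hbx : ∀ x ∈ S, ∀ i, b i ≤ x.1 i := by
    intro x hx i
    simp only [b]
    split_ifs
    · exact hm i x hx
    · exact Nat.zero_le _
  have hclose : ∀ x ∈ S, ∀ i, x.1 i < b i + Fintype.card I := by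
    intro x hx i
    have h1 := Finset.sum_le_sum (s := Finset.univ.erase i) fun j _ => hbx x hx j
    have h2 := Finset.add_sum_erase Finset.univ b (Finset.mem_univ i)
    have h3 := Finset.add_sum_erase Finset.univ x.1 (Finset.mem_univ i)
    have h4 := hT x
    omega
  refine ⟨S, hS, fun x hx y hy i => ?_, fun i hi x hx => ?_⟩
  · have := hclose x hx i
    have := hbx y hy i
    omega
  · have h1 := hclose x hx i
    have h2 : b i = 0 := if_neg (by simpa using fun s hs' hs => hi ⟨s, hs'⟩ hs)
    omega

/-- Colour each point of a fine grid by a coordinate that `f` does not decrease, which exists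
because the coordinate sums agree. In a set of close points, uniform continuity carries the
inequality of an occurring colour to every point, and coordinates of missing colours are below `ε`.
-/
theorem exists_approx_fixedPoint_stdSimplex {I : Type*} [Fintype I] [Nonempty I]
    {f : (I → ℝ) → I → ℝ} (hf : ContinuousOn f (stdSimplex ℝ I))
    (hmaps : Set.MapsTo f (stdSimplex ℝ I) (stdSimplex ℝ I)) {ε : ℝ} (hε : 0 < ε) :
    ∃ z ∈ stdSimplex ℝ I, ∀ i, z i ≤ f z i + ε := by
  classical
  obtain ⟨δ, hδ, hfδ⟩ := Metric.uniformContinuousOn_iff.1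
    ((isCompact_stdSimplex (𝕜 := ℝ) I).uniformContinuousOn_of_continuous hf) (ε / 2) (by positivity)
  obtain ⟨N, hN⟩ := exists_nat_gt ((Fintype.card I : ℝ) / min δ (ε / 2))
  have hη : 0 < min δ (ε / 2) := by positivity
  have hN0 : (0 : ℝ) < N := lt_of_le_of_lt (by positivity) hN
  have hcardN : (Fintype.card I : ℝ) / N < min δ (ε / 2) := by
    rw [div_lt_iff₀ hη] at hN
    rw [div_lt_iff₀ hN0]; linarith
  let z : (Finset.univ : Finset I).piAntidiag N → I → ℝ := fun t i => (t.1 i : ℝ) / N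
  have hz : ∀ t, z t ∈ stdSimplex ℝ I := by
    intro t
    refine ⟨fun i => by positivity, ?_⟩
    simp only [z]
    rw [← Finset.sum_div, ← Nat.cast_sum, (Finset.mem_piAntidiag.1 t.2).1, div_self hN0.ne']
  have hcol : ∀ t, ∃ i, z t i ≤ f (z t) i := by
    intro t
    by_contra hcon
    push Not at hcon
    have := Finset.sum_lt_sum_of_nonempty Finset.univ_nonempty fun i _ => hcon i
    rw [(hmaps (hz t)).2, (hz t).2] at this
    exact lt_irrefl _ this
  choose c hc using hcol
  obtain ⟨S, ⟨t, ht⟩, hclose, hsmall⟩ := exists_close_grid_points N c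
  have hzclose : ∀ x ∈ S, ∀ y ∈ S, ∀ i, z x i < z y i + min δ (ε / 2) := by
    intro x hx y hy i
    have h : (x.1 i : ℝ) < y.1 i + Fintype.card I := by exact_mod_cast hclose x hx y hy i
    calc z x i = (x.1 i : ℝ) / N := rfl
      _ < (y.1 i + Fintype.card I) / N := by gcongr
      _ = z y i + Fintype.card I / N := add_div _ _ _
      _ < _ := by gcongr
  refine ⟨z t, hz t, fun i => ?_⟩
  by_cases hi : ∃ s ∈ S, c s = i
  · obtain ⟨s, hs, rfl⟩ := hi
    have hdist : dist (z s) (z t) < δ := by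
      rw [dist_pi_lt_iff hδ]
      intro j
      rw [Real.dist_eq, abs_sub_lt_iff]
      have h1 := hzclose s hs t ht j
      have h2 := hzclose t ht s hs j
      have h3 := min_le_left δ (ε / 2)
      constructor <;> linarith
    have h1 := (dist_pi_lt_iff (by positivity)).1 (hfδ _ (hz s) _ (hz t) hdist) (c s)
    rw [Real.dist_eq, abs_sub_lt_iff] at h1
    have h2 := hzclose t ht s hs (c s)
    have h3 := min_le_right δ (ε / 2)
    linarith [hc s, h1.1]
  · push Not at hi
    have h : (t.1 i : ℝ) < Fintype.card I := by exact_mod_cast hsmall i hi t ht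
    have h1 : z t i ≤ Fintype.card I / N := by
      show (t.1 i : ℝ) / N ≤ _
      gcongr
    have h2 := min_le_right δ (ε / 2)
    linarith [(hmaps (hz t)).1 i]

/-- **Brouwer's fixed point theorem** for the standard simplex. -/
theorem exists_fixedPoint_stdSimplex {I : Type*} [Fintype I] [Nonempty I]
    {f : (I → ℝ) → I → ℝ} (hf : ContinuousOn f (stdSimplex ℝ I))
    (hmaps : Set.MapsTo f (stdSimplex ℝ I) (stdSimplex ℝ I)) :
    ∃ z ∈ stdSimplex ℝ I, f z = z := by
  classical
  obtain ⟨i₀⟩ := ‹Nonempty I›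
  -- Approximate fixed points force the minimum of `h` to be zero; then `z ≤ f z`, and equal sums
  -- give equality.
  let h : (I → ℝ) → ℝ := fun z => ∑ i, max 0 (z i - f z i)
  have hcont : ContinuousOn h (stdSimplex ℝ I) := by
    refine continuousOn_finsetSum _ fun i _ => ?_
    exact (continuous_const.max continuous_id).comp_continuousOn
      ((continuous_apply i).continuousOn.sub ((continuous_apply i).comp_continuousOn hf))
  obtain ⟨z, hz, hzmin⟩ := (isCompact_stdSimplex (𝕜 := ℝ) I).exists_isMinOn
    ⟨_, single_mem_stdSimplex ℝ i₀⟩ hcont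
  have hz0 : h z ≤ 0 := by
    refine le_of_forall_pos_le_add fun ε hε => ?_
    have hc : (0 : ℝ) < Fintype.card I := by
      exact_mod_cast Fintype.card_pos_iff.2 ⟨i₀⟩
    obtain ⟨w, hw, hwε⟩ := exists_approx_fixedPoint_stdSimplex hf hmaps
      (ε := ε / Fintype.card I) (by positivity)
    calc h z ≤ h w := hzmin hw
      _ ≤ ∑ _i : I, ε / Fintype.card I := Finset.sum_le_sum fun i _ =>
          max_le (by positivity) (by linarith [hwε i])
      _ = 0 + ε := by
          rw [Finset.sum_const, Finset.card_univ, nsmul_eq_mul]; field_simp; simp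
  have hle : ∀ i, z i ≤ f z i := by
    intro i
    have := Finset.single_le_sum (f := fun i => max 0 (z i - f z i))
      (fun i _ => le_max_left _ _) (Finset.mem_univ i)
    have h1 : z i - f z i ≤ max 0 (z i - f z i) := le_max_right _ _
    have h2 : max 0 (z i - f z i) ≤ 0 := this.trans hz0
    linarith
  refine ⟨z, hz, funext fun i => ?_⟩
  exact ((Finset.sum_eq_sum_iff_of_le fun i _ => hle i).1
    (by rw [hz.2, (hmaps hz).2]) i (Finset.mem_univ i)).symm

/-! ### Ky Fan's inequality -/

/-- Nash's map moves weight towards the points `y i` that improve on the barycentre `g w`, with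
gains `d i`. At a fixed point `d i w = w i * D`; if `D > 0`, the `w`-average of `φ (g w) (g w) - φ
(g w) (y i)` is `∑ w i ^ 2 * D > 0`, against Jensen. -/
theorem exists_forall_finset_le_of_convexOn {E : Type*} [AddCommGroup E] [Module ℝ E]
    [TopologicalSpace E] [ContinuousAdd E] [ContinuousSMul ℝ E] {K : Set E} (hKc : Convex ℝ K)
    (hKne : K.Nonempty) {φ : E → E → ℝ} (hφ : Continuous fun q : E × E => φ q.1 q.2)
    (hφc : ∀ x, ConvexOn ℝ Set.univ (φ x)) (a : Finset K) :
    ∃ x ∈ K, ∀ y ∈ a, φ x x ≤ φ x y := by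
  rcases a.eq_empty_or_nonempty with rfl | ⟨y₀, hy₀⟩
  · obtain ⟨x, hx⟩ := hKne
    exact ⟨x, hx, by simp⟩
  have : Nonempty a := ⟨⟨y₀, hy₀⟩⟩
  let g : (a → ℝ) → E := fun w => ∑ i, w i • (i.1 : E)
  have hg : Continuous g :=
    continuous_finsetSum _ fun i _ => (continuous_apply i).smul continuous_const
  let d : a → (a → ℝ) → ℝ := fun i w => max 0 (φ (g w) (g w) - φ (g w) i.1)
  have hd : ∀ i, Continuous (d i) := fun i =>
    continuous_const.max ((hφ.comp (hg.prodMk hg)).sub (hφ.comp (hg.prodMk continuous_const)))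
  have hd0 : ∀ i w, 0 ≤ d i w := fun i w => le_max_left _ _
  have hD0 : ∀ w, 0 ≤ ∑ i, d i w := fun w => Finset.sum_nonneg fun i _ => hd0 i w
  obtain ⟨w, hw, hfix⟩ := exists_fixedPoint_stdSimplex
    (f := fun w i => (w i + d i w) / (1 + ∑ j, d j w))
    (by
      refine Continuous.continuousOn (continuous_pi fun i => ?_)
      exact ((continuous_apply i).add (hd i)).div
        (continuous_const.add (continuous_finsetSum _ fun j _ => hd j))
        fun w => by have := hD0 w; positivity)
    (by
      intro w hw
      have := hD0 w
      refine ⟨fun i => div_nonneg (add_nonneg (hw.1 i) (hd0 i w)) (by positivity), ?_⟩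
      rw [← Finset.sum_div, Finset.sum_add_distrib, hw.2, div_self (by positivity)])
  set D := ∑ j, d j w with hD
  have hdw : ∀ i, d i w = w i * D := by
    intro i
    have h := congrFun hfix i
    have := hD0 w
    rw [div_eq_iff (by positivity)] at h
    linarith
  have hjensen : φ (g w) (g w) ≤ ∑ i, w i * φ (g w) i.1 := by
    simpa only [smul_eq_mul] using (hφc (g w)).map_sum_le (t := Finset.univ) (w := w) (p := fun i : a => (i.1 : E))
      (fun i _ => hw.1 i) hw.2 (fun _ _ => Set.mem_univ _)
  have hDzero : D = 0 := by
    by_contra hDne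
    have hDpos : 0 < D := (hD0 w).lt_of_ne' hDne
    have hmul : ∀ i, w i * (φ (g w) (g w) - φ (g w) i.1) = w i ^ 2 * D := by
      intro i
      rcases (hw.1 i).eq_or_lt with h | h
      · simp [← h]
      · have h1 : 0 < d i w := by rw [hdw]; positivity
        have h2 : d i w = φ (g w) (g w) - φ (g w) i.1 := by
          rcases max_choice 0 (φ (g w) (g w) - φ (g w) i.1) with h3 | h3
          · exact absurd h3 h1.ne'
          · exact h3
        rw [← h2, hdw]; ring
    have hsum : ∑ i, w i ^ 2 * D ≤ 0 := by
      simp only [← hmul, mul_sub, Finset.sum_sub_distrib]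
      rw [← Finset.sum_mul, hw.2]
      linarith
    have hzero := (Finset.sum_eq_zero_iff_of_nonneg fun i _ => by positivity).1
      (le_antisymm hsum (Finset.sum_nonneg fun i _ => by positivity))
    have : ∑ i, w i = 0 := Finset.sum_eq_zero fun i hi => by
      simpa [hDne] using hzero i hi
    rw [hw.2] at this
    exact one_ne_zero this
  refine ⟨g w, hKc.sum_mem (fun i _ => hw.1 i) hw.2 fun i _ => i.1.2, fun y hy => ?_⟩
  have h1 : d ⟨y, hy⟩ w = 0 := by rw [hdw, hDzero, mul_zero]
  have h2 : φ (g w) (g w) - φ (g w) y ≤ d ⟨y, hy⟩ w := le_max_right _ _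
  linarith

/-- **Ky Fan's inequality** for a continuous function that is convex in its second variable. -/
theorem exists_forall_le_of_convexOn {E : Type*} [AddCommGroup E] [Module ℝ E]
    [TopologicalSpace E] [ContinuousAdd E] [ContinuousSMul ℝ E] {K : Set E} (hK : IsCompact K)
    (hKc : Convex ℝ K) (hKne : K.Nonempty) {φ : E → E → ℝ}
    (hφ : Continuous fun q : E × E => φ q.1 q.2) (hφc : ∀ x, ConvexOn ℝ Set.univ (φ x)) :
    ∃ x ∈ K, ∀ y ∈ K, φ x x ≤ φ x y := by
  obtain ⟨x, hx, hx'⟩ := hK.inter_iInter_nonempty (fun y : K => {x | φ x x ≤ φ x y})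
    (fun y => isClosed_le (hφ.comp (continuous_id.prodMk continuous_id))
      (hφ.comp (continuous_id.prodMk continuous_const)))
    (fun a => by
      obtain ⟨x, hx, h⟩ := exists_forall_finset_le_of_convexOn hKc hKne hφ hφc a
      exact ⟨x, hx, by simpa using h⟩)
  rw [Set.mem_iInter] at hx'
  exact ⟨x, hx, fun y hy => hx' ⟨y, hy⟩⟩

/-! ### Compactness of balls and passage from the ball to `X` -/

theorem Seminorm.continuous_of_finiteDimensional {E : Type*} [NormedAddCommGroup E]
    [NormedSpace ℝ E] [FiniteDimensional ℝ E] (p : Seminorm ℝ E) : Continuous p :=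
  continuousOn_univ.1 (p.convexOn.continuousOn isOpen_univ)

/-- On the unit sphere `p` has a positive minimum `p v`, so the ball is bounded by `ρ / p v`. -/
theorem Seminorm.isCompact_closedBall_of_finiteDimensional {E : Type*} [NormedAddCommGroup E]
    [NormedSpace ℝ E] [FiniteDimensional ℝ E] {p : Seminorm ℝ E} (hp : ∀ x, p x = 0 → x = 0)
    (ρ : ℝ) : IsCompact {x | p x ≤ ρ} := by
  have := FiniteDimensional.proper_real E
  have hcont := p.continuous_of_finiteDimensional
  refine Metric.isCompact_of_isClosed_isBounded (isClosed_le hcont continuous_const) ?_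
  rcases (Metric.sphere (0 : E) 1).eq_empty_or_nonempty with h | h
  · refine (Bornology.isBounded_singleton (x := (0 : E))).subset ?_
    intro x _
    by_contra hx
    have hx : x ≠ 0 := hx
    have : ‖x‖⁻¹ • x ∈ Metric.sphere (0 : E) 1 := by
      rw [mem_sphere_zero_iff_norm, norm_smul, norm_inv, norm_norm,
        inv_mul_cancel₀ (norm_ne_zero_iff.2 hx)]
    rw [h] at this
    exact this
  · obtain ⟨v, hv, hmin⟩ := (isCompact_sphere (0 : E) 1).exists_isMinOn h hcont.continuousOn
    have hv0 : v ≠ 0 := by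
      rintro rfl
      simp at hv
    have hpv : 0 < p v := (apply_nonneg p v).lt_of_ne' fun h => hv0 (hp v h)
    refine (Metric.isBounded_closedBall (x := (0 : E)) (r := ρ / p v)).subset fun x hx => ?_
    rw [mem_closedBall_zero_iff, le_div_iff₀ hpv]
    by_cases hx0 : x = 0
    · subst hx0
      simpa using hx
    · have hxs : ‖x‖⁻¹ • x ∈ Metric.sphere (0 : E) 1 := by
        rw [mem_sphere_zero_iff_norm, norm_smul, norm_inv, norm_norm,
          inv_mul_cancel₀ (norm_ne_zero_iff.2 hx0)]
      have h1 : p v ≤ p (‖x‖⁻¹ • x) := hmin hxs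
      rw [map_smul_eq_mul, norm_inv, norm_norm, inv_mul_eq_div,
        le_div_iff₀ (norm_pos_iff.2 hx0)] at h1
      rw [mul_comm]
      exact h1.trans hx

/-- A point `x` of a convex set `X` which minimizes a convex function over a sublevel set of a
seminorm minimizes it over `X`, if the value at `x` is attained or improved at a point of `X` of
smaller seminorm. -/
theorem ConvexOn.le_of_forall_seminorm_le {E : Type*} [AddCommGroup E] [Module ℝ E] {X : Set E}
    (hX : Convex ℝ X) {p : Seminorm ℝ E} {ρ : ℝ} {f : E → ℝ} (hf : ConvexOn ℝ Set.univ f) {c : ℝ}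
    (hc : ∀ y ∈ X, p y ≤ ρ → c ≤ f y) {y₀ : E} (hy₀ : y₀ ∈ X) (hpy₀ : p y₀ < ρ) (hfy₀ : f y₀ ≤ c)
    {y : E} (hy : y ∈ X) : c ≤ f y := by
  -- A short step from `y₀` towards `y` stays in the ball; the `+ 1` in the witness covers `p y =
  -- 0`.
  obtain ⟨t, ht0, ht1, htρ⟩ : ∃ t : ℝ, 0 < t ∧ t ≤ 1 ∧ t * p y ≤ ρ - p y₀ := by
    have hpy := apply_nonneg p y
    refine ⟨min 1 ((ρ - p y₀) / (p y + 1)), lt_min one_pos (div_pos (by linarith) (by linarith)),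
      min_le_left _ _, ?_⟩
    calc _ ≤ (ρ - p y₀) / (p y + 1) * (p y + 1) := by
          refine mul_le_mul (min_le_right _ _) (by linarith) hpy (div_nonneg ?_ ?_) <;> linarith
      _ = _ := div_mul_cancel₀ _ (by linarith)
  have hmem : (1 - t) • y₀ + t • y ∈ X := hX hy₀ hy (by linarith) ht0.le (by ring)
  have hp : p ((1 - t) • y₀ + t • y) ≤ ρ := by
    calc _ ≤ p ((1 - t) • y₀) + p (t • y) := map_add_le_add p _ _
      _ = (1 - t) * p y₀ + t * p y := by
        rw [map_smul_eq_mul, map_smul_eq_mul, Real.norm_of_nonneg ht0.le,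
          Real.norm_of_nonneg (by linarith : (0 : ℝ) ≤ 1 - t)]
      _ ≤ ρ := by nlinarith [apply_nonneg p y₀]
  have h1 := hc _ hmem hp
  have h2 := hf.2 (Set.mem_univ y₀) (Set.mem_univ y) (by linarith : (0 : ℝ) ≤ 1 - t) ht0.le
    (by ring)
  simp only [smul_eq_mul] at h2
  have h3 : t * c ≤ t * f y := by nlinarith
  exact le_of_mul_le_mul_left h3 ht0

/-! ### Existence of equilibria -/

theorem mainTheorem4 {N : Type*} [Fintype N] [Nonempty N] [DecidableEq N] (n : N → ℕ)
    (p : Seminorm ℝ (RosenGame.Profile n)) (hp : ∀ x, p x = 0 → x = 0)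
    (θ : N → RosenGame.Profile n → ℝ) (X : Set (RosenGame.Profile n))
    (hXconvex : Convex ℝ X) (hXclosed : IsClosed X) (hXne : X.Nonempty)
    (hθcont : ∀ ν, Continuous (θ ν))
    (hθconvex : ∀ ν, RosenGame.ConvexInOwnVariable θ ν)
    (hC0 : ∃ ρ : ℝ, 0 < ρ ∧ RosenGame.CoerciveC0 p θ X ρ) :
    (RosenGame.equilibria θ X).Nonempty := by
  obtain ⟨ρ, -, hne, hcoer⟩ := hC0
  let φ : RosenGame.Profile n → RosenGame.Profile n → ℝ := fun x y =>
    ∑ ν, θ ν (RosenGame.deviate x ν (y ν))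
  have hφ : Continuous fun q : RosenGame.Profile n × RosenGame.Profile n => φ q.1 q.2 :=
    continuous_finsetSum _ fun ν _ => (hθcont ν).comp
      (continuous_fst.update ν ((continuous_apply ν).comp continuous_snd))
  have hφc : ∀ x, ConvexOn ℝ Set.univ (φ x) := by
    intro x
    refine ⟨convex_univ, fun y _ z _ s t hs ht hst => ?_⟩
    simp only [φ, smul_eq_mul, Finset.mul_sum, ← Finset.sum_add_distrib]
    exact Finset.sum_le_sum fun ν _ =>
      (hθconvex ν x).2 (Set.mem_univ (y ν)) (Set.mem_univ (z ν)) hs ht hst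
  have hself : ∀ x : RosenGame.Profile n, ∀ ν, RosenGame.deviate x ν (x ν) = x := fun x ν =>
    Function.update_eq_self ν x
  obtain ⟨x, ⟨hxX, hxρ⟩, hx⟩ := exists_forall_le_of_convexOn
    (((Seminorm.isCompact_closedBall_of_finiteDimensional hp ρ).inter_left hXclosed))
    (hXconvex.inter (by simpa using p.convexOn.convex_le ρ)) hne hφ hφc
  obtain ⟨y₀, hy₀, hpy₀, hφy₀⟩ : ∃ y ∈ X, p y < ρ ∧ φ x y ≤ φ x x := by
    rcases (show p x ≤ ρ from hxρ).lt_or_eq with h | h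
    · exact ⟨x, hxX, h, le_rfl⟩
    · obtain ⟨y, hy, hpy, hle⟩ := hcoer x hxX h
      exact ⟨y, hy, hpy, Finset.sum_le_sum fun ν _ => by rw [hself]; exact hle ν⟩
  have hmin : ∀ y ∈ X, φ x x ≤ φ x y := fun y hy =>
    (hφc x).le_of_forall_seminorm_le hXconvex (fun y hy hpy => hx y ⟨hy, hpy⟩) hy₀ hpy₀ hφy₀ hy
  refine ⟨x, fun ν => ⟨?_, fun z hz => ?_⟩⟩
  · show RosenGame.deviate x ν (x ν) ∈ X
    rwa [hself]
  · have h := hmin _ hz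
    -- A deviation of `ν` alone changes only the `ν`-th summand of `φ x`.
    have hothers : ∀ μ ∈ Finset.univ.erase ν,
        θ μ (RosenGame.deviate x μ (RosenGame.deviate x ν z μ)) =
          θ μ (RosenGame.deviate x μ (x μ)) := fun μ hμ => by
      rw [show RosenGame.deviate x ν z μ = x μ from
        Function.update_of_ne (Finset.ne_of_mem_erase hμ) _ _]
    have hown : RosenGame.deviate x ν z ν = z := Function.update_self (β := fun ν => Fin (n ν) → ℝ) ν z x
    simp only [φ] at h
    rw [← Finset.add_sum_erase _ _ (Finset.mem_univ ν),
      ← Finset.add_sum_erase _ _ (Finset.mem_univ ν), Finset.sum_congr rfl hothers, hown] at h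
    linarith
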